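/- Let $H$ be a right quaternionic Hilbert space, i.e. a right $\mathbb{H}$-module with an inner product $\langle\cdot|\cdot\rangle\colon H\times H\to\mathbb{H}$ that is right $\mathbb{H}$-linear in the second variable, satisfies $\langle u|v\rangle=\overline{\langle v|u\rangle}$ and $\langle u|u\rangle>0$ for $u\neq0$, and is complete for the norm $\|u\|=\langle u|u\rangle^{1/2}$. Operators are right $\mathbb{H}$-linear maps $T\colon\mathcal{D}(T)\to H$ on a right $\mathbb{H}$-submodule $\mathcal{D}(T)\subseteq H$; two operators are equal if they have the same domain and the same values, and $ST$ has domain $\{x\in\mathcal{D}(T): Tx\in\mathcal{D}(S)\}$. For densely defined $T$, the adjoint $T^*$ is given by $T^*x=z$ if and only if $\langle x|Ty\rangle=\langle z|y\rangle$ for all $y\in\mathcal{D}(T)$. An operator $T$ is called positive if it is densely defined, $T=T^*$, and $\langle x|Tx\rangle$ is a real number $\ge 0$ for all $x\in\mathcal{D}(T)$. A positive square root of $T$ is a positive operator $S$ with $S^2=T$. A bounded right $\mathbb{H}$-linear operator $B\colon H\to H$ commutes with $T$ if, for every $x\in\mathcal{D}(T)$, $Bx\in\mathcal{D}(T)$ and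 $TBx=BTx$. Theorem. Let $T\colon\mathcal{D}(T)\to H$ be a (possibly unbounded) positive operator. Then $T$ has a unique positive square root. Moreover, this square root commutes with every bounded right $\mathbb{H}$-linear operator on $H$ that commutes with $T$. Corollary. Let $T\colon\mathcal{D}(T)\to H$ be a densely defined closed right $\mathbb{H}$-linear operator. Then $T^*T$ has a unique positive square root, denoted $|T|=(T^*T)^{1/2}$. Moreover, $|T|$ commutes with every bounded right $\mathbb{H}$-linear operator on $H$ that commutes with both $T$ and $T^*$. -/

import Mathlib

open scoped Quaternion

noncomputable section

/-- A right `ℍ`-module `H` (i.e. a module over the opposite ring, `x · q = MulOpposite.op q • x`)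
with an `ℍ`-valued inner product, positive definite, right linear in the second variable and
conjugate symmetric, whose induced norm `√⟨x | x⟩` is the norm of `H`.  With `[CompleteSpace H]`
this is a right quaternionic Hilbert space. -/
class QuaternionicInnerProductSpace (H : Type*) [NormedAddCommGroup H] [Module ℍ[ℝ]ᵐᵒᵖ H]
    extends Inner ℍ[ℝ] H where
  /-- `⟨u | v + w⟩ = ⟨u | v⟩ + ⟨u | w⟩` -/
  quatInner_add_right : ∀ u v w : H, inner u (v + w) = inner u v + inner u w
  /-- `⟨u | v · q⟩ = ⟨u | v⟩ q` -/
  quatInner_smul_right : ∀ (u v : H) (q : ℍ[ℝ]), inner u (MulOpposite.op q • v) = inner u v * q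
  /-- `⟨u | v⟩` is the quaternionic conjugate of `⟨v | u⟩` -/
  quatInner_conj_symm : ∀ u v : H, inner u v = star (inner v u)
  /-- `⟨u | u⟩ = ‖u‖ ^ 2`; in particular `⟨u | u⟩` is real, nonnegative, and zero only at `0` -/
  quatInner_self : ∀ u : H, inner u u = ((‖u‖ ^ 2 : ℝ) : ℍ[ℝ])

namespace QuaternionicHilbert

variable {H : Type*} [NormedAddCommGroup H] [Module ℍ[ℝ]ᵐᵒᵖ H] [QuaternionicInnerProductSpace H]

open QuaternionicInnerProductSpace

theorem quatInner_add_left (u v w : H) :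
    inner ℍ[ℝ] (u + v) w = inner ℍ[ℝ] u w + inner ℍ[ℝ] v w := by
  rw [quatInner_conj_symm, quatInner_add_right, star_add, ← quatInner_conj_symm, ← quatInner_conj_symm]

theorem quatInner_smul_left (u v : H) (q : ℍ[ℝ]) :
    inner ℍ[ℝ] (MulOpposite.op q • u) v = star q * inner ℍ[ℝ] u v := by
  rw [quatInner_conj_symm, quatInner_smul_right, star_mul, ← quatInner_conj_symm]

theorem quatInner_zero_left (v : H) : inner ℍ[ℝ] (0 : H) v = 0 := by
  have h := quatInner_add_left (0 : H) 0 v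
  simpa using h

/-- The right `ℍ`-submodule of all pairs `(x, z)` with `⟨x | T y⟩ = ⟨z | y⟩` for every `y` in the
domain of `T`. -/
def adjointGraph (T : H →ₗ.[ℍ[ℝ]ᵐᵒᵖ] H) : Submodule ℍ[ℝ]ᵐᵒᵖ (H × H) where
  carrier := {p | ∀ y : T.domain, inner ℍ[ℝ] p.1 (T y) = inner ℍ[ℝ] p.2 (y : H)}
  add_mem' := by
    intro p p' hp hp' y
    simp only [Prod.fst_add, Prod.snd_add, quatInner_add_left]
    rw [hp y, hp' y]
  zero_mem' := by
    intro y
    simp only [Prod.fst_zero, Prod.snd_zero, quatInner_zero_left]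
  smul_mem' := by
    intro q p hp y
    have h := hp y
    rw [← MulOpposite.op_unop q]
    simp only [Prod.smul_fst, Prod.smul_snd, quatInner_smul_left]
    rw [h]

/-- The adjoint `T*` of a densely defined right `ℍ`-linear operator `T`: its graph is
`adjointGraph T` (see `graph_adjoint`).  Only meaningful when the domain of `T` is dense. -/
def adjoint (T : H →ₗ.[ℍ[ℝ]ᵐᵒᵖ] H) : H →ₗ.[ℍ[ℝ]ᵐᵒᵖ] H :=
  (adjointGraph T).toLinearPMap

theorem norm_add_sq (u v : H) :
    ‖u + v‖ ^ 2 = ‖u‖ ^ 2 + 2 * (inner ℍ[ℝ] u v).re + ‖v‖ ^ 2 := by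
  have hn (w : H) : (inner ℍ[ℝ] w w).re = ‖w‖ ^ 2 := by
    rw [quatInner_self, Quaternion.re_coe]
  have hs : (inner ℍ[ℝ] v u).re = (inner ℍ[ℝ] u v).re := by
    rw [quatInner_conj_symm v u, Quaternion.re_star]
  rw [← hn (u + v), ← hn u, ← hn v, quatInner_add_right, quatInner_add_left, quatInner_add_left]
  simp only [Quaternion.re_add, hs]
  ring

/-- A vector orthogonal to a dense set is zero. -/
theorem eq_zero_of_dense {s : Set H} (hs : Dense s) {z : H}
    (hz : ∀ y ∈ s, inner ℍ[ℝ] z y = 0) : z = 0 := by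
  have hc : Set.EqOn (fun y : H => ‖z + y‖ ^ 2) (fun y : H => ‖z‖ ^ 2 + ‖y‖ ^ 2) s := by
    intro y hy
    simp only [norm_add_sq, hz y hy, Quaternion.re_zero]
    ring
  have he := Continuous.ext_on hs (by fun_prop) (by fun_prop) hc
  have h1 := congrFun he z
  have h2 := norm_add_sq z z
  have h3 : (inner ℍ[ℝ] z z).re = ‖z‖ ^ 2 := by
    rw [quatInner_self, Quaternion.re_coe]
  change ‖z + z‖ ^ 2 = ‖z‖ ^ 2 + ‖z‖ ^ 2 at h1
  have h4 : ‖z‖ ^ 2 = 0 := by linarith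
  simpa using h4

/-- For densely defined `T`, the graph of `T*` is exactly the set of pairs `(x, z)` such that
`⟨x | T y⟩ = ⟨z | y⟩` for every `y` in the domain of `T`. -/
theorem graph_adjoint (T : H →ₗ.[ℍ[ℝ]ᵐᵒᵖ] H) (hT : Dense (T.domain : Set H)) :
    (adjoint T).graph = adjointGraph T := by
  refine Submodule.toLinearPMap_graph_eq _ ?_
  intro p hp h0
  refine eq_zero_of_dense hT ?_
  intro y hy
  have h := hp ⟨y, hy⟩
  rw [h0, quatInner_zero_left] at h
  exact h.symm

/-- The product `S T` of two operators, with domain `{x ∈ D(T) : T x ∈ D(S)}`. -/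
def prod (S T : H →ₗ.[ℍ[ℝ]ᵐᵒᵖ] H) : H →ₗ.[ℍ[ℝ]ᵐᵒᵖ] H where
  domain :=
    { carrier := {x | ∃ h : x ∈ T.domain, T ⟨x, h⟩ ∈ S.domain}
      add_mem' := by
        rintro x y ⟨hx, hx'⟩ ⟨hy, hy'⟩
        refine ⟨T.domain.add_mem hx hy, ?_⟩
        have h := T.map_add ⟨x, hx⟩ ⟨y, hy⟩
        rw [AddMemClass.mk_add_mk] at h
        rw [h]
        exact S.domain.add_mem hx' hy'
      zero_mem' := by
        refine ⟨T.domain.zero_mem, ?_⟩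
        have h := T.map_zero
        change T ⟨0, _⟩ = 0 at h
        rw [h]
        exact S.domain.zero_mem
      smul_mem' := by
        rintro q x ⟨hx, hx'⟩
        refine ⟨T.domain.smul_mem q hx, ?_⟩
        have h := T.map_smul q ⟨x, hx⟩
        rw [SetLike.mk_smul_mk] at h
        rw [h]
        exact S.domain.smul_mem q hx' }
  toFun :=
    { toFun := fun x => S ⟨T ⟨x.1, x.2.fst⟩, x.2.snd⟩
      map_add' := by
        intro x y
        rw [← S.map_add]
        congr 1
        exact Subtype.ext (T.map_add ⟨x.1, x.2.fst⟩ ⟨y.1, y.2.fst⟩)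
      map_smul' := by
        intro q x
        rw [RingHom.id_apply, ← S.map_smul]
        congr 1
        exact Subtype.ext (T.map_smul q ⟨x.1, x.2.fst⟩) }

/-- `T` is positive: densely defined, self-adjoint (`T* = T`, including equality of domains), and
`⟨x | T x⟩` is a nonnegative real number for every `x` in the domain of `T`. -/
structure IsPositive (T : H →ₗ.[ℍ[ℝ]ᵐᵒᵖ] H) : Prop where
  dense_domain : Dense (T.domain : Set H)
  self_adjoint : adjoint T = T
  nonneg : ∀ x : T.domain, ∃ r : ℝ, 0 ≤ r ∧ inner ℍ[ℝ] (x : H) (T x) = (r : ℍ[ℝ])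

/-- `S` is a positive square root of `T`: `S` is positive and `S S = T`, including equality of
domains. -/
def IsPositiveSqrt (S T : H →ₗ.[ℍ[ℝ]ᵐᵒᵖ] H) : Prop :=
  IsPositive S ∧ prod S S = T

/-- `T` commutes with the everywhere defined bounded operator `B`, i.e. `B T ⊆ T B`: for every `x`
in the domain of `T`, also `B x` is in the domain of `T`, and `T B x = B T x`. -/
def CommutesWith (T : H →ₗ.[ℍ[ℝ]ᵐᵒᵖ] H) (B : H →L[ℍ[ℝ]ᵐᵒᵖ] H) : Prop :=
  ∀ x : T.domain, ∃ h : B (x : H) ∈ T.domain, T ⟨B (x : H), h⟩ = B (T x)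

end QuaternionicHilbert

end

/-! Restricting scalars to ℂ ⊆ ℍ makes `H` a complex Hilbert space, and the problem moves to the
bounded operator A = (1 + T)⁻¹, which satisfies 0 ≤ A ≤ 1 (`IsPositive.exists_resolvent`). With C =
A^(1/2) and D = (1 - A)^(1/2), T = (1 - A) A⁻¹ = (D C⁻¹)², so S = D C⁻¹, with graph {(C v, D v)}, is
a root (`exists_isPositive_of_sqrt_pair`). C and D commute with every continuous additive map that
commutes with A (`exists_sqrt_pair`): right multiplications by quaternions make S quaternionic
linear, and bounded B commuting with T commute with S.

Uniqueness: for another root R, the operator R A is bounded and positive with square A (1 - A) = (C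
D)², so R A = C D by uniqueness for bounded operators. Closedness of R then gives S ⊆ R, and
self-adjointness turns this into equality.

The corollary needs T*T to be positive. This rests on surjectivity of 1 + T*T, obtained by
projecting (v, 0) orthogonally onto the graph of T. -/

noncomputable section
namespace QuaternionicHilbert
open QuaternionicInnerProductSpace

/-! ### Square roots of bounded operators and commutation -/

/-- A continuous additive map commuting with a positive operator commutes with its square root. -/
theorem sqrt_apply_comm {E : Type*} [NormedAddCommGroup E] [InnerProductSpace ℂ E]
    [CompleteSpace E] {A : E →L[ℂ] E} (hA : 0 ≤ A) (f : E →+ E) (hf : Continuous f)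
    (h : ∀ v, f (A v) = A (f v)) (v : E) : f (CFC.sqrt A v) = CFC.sqrt A (f v) := by
  -- The real closed algebra is used because a continuous additive `f` is only real-linear; right
  -- multiplication by a quaternion need not be complex-linear.
  have hm : CFC.sqrt A ∈ StarAlgebra.elemental ℝ A := by
    rw [CFC.sqrt_eq_real_sqrt A hA, cfcₙ_eq_cfc]
    exact cfc_mem_elemental _ _
  revert v
  refine StarAlgebra.elemental.induction_on ℝ hm
    (P := fun X _ => ∀ v, f (X v) = X (f v)) h ?_ ?_ ?_ ?_ ?_
  · rwa [(IsSelfAdjoint.of_nonneg hA).star_eq]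
  · intro r v
    rw [Algebra.algebraMap_eq_smul_one]
    exact map_real_smul f hf r v
  · intro X _ Y _ hX hY v
    simp only [add_apply, map_add, hX, hY]
  · intro X _ Y _ hX hY v
    exact (hX _).trans (congrArg X (hY v))
  · intro s _ hs X hX v
    have hc : IsClosed {X : E →L[ℂ] E | f (X v) = X (f v)} :=
      isClosed_eq (hf.comp (ContinuousLinearMap.apply ℂ E v).continuous)
        (ContinuousLinearMap.apply ℂ E (f v)).continuous
    exact closure_minimal (fun u hu => hs u hu v) hc hX

/-- `A` and `1 - A` have commuting positive square roots, which commute with all continuous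
additive maps that commute with `A`. -/
theorem exists_sqrt_pair {E : Type*} [NormedAddCommGroup E] [InnerProductSpace ℂ E]
    [CompleteSpace E] {A : E →L[ℂ] E} (hA : 0 ≤ A) (hA' : 0 ≤ 1 - A) :
    ∃ C D : E →L[ℂ] E, 0 ≤ C ∧ 0 ≤ D ∧ C * C = A ∧ D * D = 1 - A ∧ Commute C D ∧
      ∀ f : E →+ E, Continuous f → (∀ v, f (A v) = A (f v)) →
        (∀ v, f (C v) = C (f v)) ∧ ∀ v, f (D v) = D (f v) := by
  have hc : ∀ f : E →+ E, Continuous f → (∀ v, f (A v) = A (f v)) →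
        (∀ v, f (CFC.sqrt A v) = CFC.sqrt A (f v)) ∧
        ∀ v, f (CFC.sqrt (1 - A) v) = CFC.sqrt (1 - A) (f v) := by
    intro f hf h
    refine ⟨sqrt_apply_comm hA f hf h, sqrt_apply_comm hA' f hf fun v => ?_⟩
    change f (v - A v) = f v - A (f v)
    rw [map_sub, h]
  refine ⟨CFC.sqrt A, CFC.sqrt (1 - A), CFC.sqrt_nonneg _, CFC.sqrt_nonneg _,
    CFC.sqrt_mul_sqrt_self A hA, CFC.sqrt_mul_sqrt_self _ hA', ?_, hc⟩
  refine ContinuousLinearMap.ext fun v => ?_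
  have hCA : Commute (CFC.sqrt A) A := by
    conv => enter [2]; rw [← CFC.sqrt_mul_sqrt_self A hA]
    exact (Commute.refl _).mul_right (Commute.refl _)
  exact (hc (CFC.sqrt A).toLinearMap.toAddMonoidHom (CFC.sqrt A).continuous
    fun v => DFunLike.congr_fun hCA v).2 v

/-! ### The complex Hilbert space underlying `H` -/

/-- The embedding of `ℂ` into the opposite quaternions. -/
def complexToQuaternionOp : ℂ →+* ℍ[ℝ]ᵐᵒᵖ :=
  Quaternion.ofComplex.toRingHom.toOpposite fun z w => by
    change Quaternion.ofComplex z * Quaternion.ofComplex w =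
      Quaternion.ofComplex w * Quaternion.ofComplex z
    rw [← map_mul, ← map_mul, mul_comm]

/-- The component in `ℂ ⊆ ℍ` of a quaternion. -/
def complexPart (q : ℍ[ℝ]) : ℂ := ⟨q.re, q.imI⟩

theorem complexPart_add (p q : ℍ[ℝ]) : complexPart (p + q) = complexPart p + complexPart q := by
  apply Complex.ext <;> simp [complexPart]

theorem complexPart_star (q : ℍ[ℝ]) : complexPart (star q) = star (complexPart q) := by
  apply Complex.ext <;> simp [complexPart]

theorem complexPart_mul_coe (q : ℍ[ℝ]) (z : ℂ) : complexPart (q * (z : ℍ[ℝ])) = complexPart q * z := by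
  apply Complex.ext <;> simp [complexPart]

variable {H : Type*} [NormedAddCommGroup H] [Module ℍ[ℝ]ᵐᵒᵖ H] [QuaternionicInnerProductSpace H]

theorem norm_op_smul (q : ℍ[ℝ]) (v : H) : ‖MulOpposite.op q • v‖ = ‖q‖ * ‖v‖ := by
  have h := quatInner_self (MulOpposite.op q • v)
  rw [quatInner_smul_right, quatInner_smul_left, quatInner_self, mul_assoc,
    Quaternion.coe_commutes, ← mul_assoc, Quaternion.star_mul_self, ← Quaternion.coe_mul,
    Quaternion.coe_inj, Quaternion.normSq_eq_norm_mul_self] at h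
  refine (sq_eq_sq₀ (norm_nonneg _) (by positivity)).mp ?_
  rw [← h]
  ring

/-- The complex inner product underlying a quaternionic one. -/
instance complexInner : InnerProductSpace ℂ H where
  toModule := Module.compHom H complexToQuaternionOp
  norm_smul_le z v := by
    change ‖MulOpposite.op (z : ℍ[ℝ]) • v‖ ≤ _
    rw [norm_op_smul]
    refine le_of_eq (congrArg (· * ‖v‖) ?_)
    refine (sq_eq_sq₀ (norm_nonneg _) (norm_nonneg _)).mp ?_
    rw [sq, ← Quaternion.normSq_eq_norm_mul_self, Quaternion.normSq_def', Complex.sq_norm,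
      Complex.normSq_apply]
    simp
    ring
  inner u v := complexPart (inner ℍ[ℝ] u v)
  norm_sq_eq_re_inner v := by
    rw [quatInner_self]
    rfl
  conj_inner_symm u v := by
    rw [quatInner_conj_symm u v, complexPart_star]
    rfl
  add_left u v w := by rw [quatInner_add_left, complexPart_add]
  smul_left u v z := by
    change complexPart (inner ℍ[ℝ] (MulOpposite.op (z : ℍ[ℝ]) • u) v) = _
    rw [quatInner_conj_symm, quatInner_smul_right, complexPart_star,
      complexPart_mul_coe, star_mul, ← complexPart_star, ← quatInner_conj_symm]
    rfl

theorem complexInner_def (u v : H) : inner ℂ u v = complexPart (inner ℍ[ℝ] u v) := rfl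

/-- A quaternionic inner product is determined by the complex parts of its right multiples. -/
theorem quatInner_eq_of_complexInner_eq {a b c d : H}
    (h : ∀ q : ℍ[ℝ], inner ℂ a (MulOpposite.op q • b) = inner ℂ c (MulOpposite.op q • d)) :
    inner ℍ[ℝ] a b = inner ℍ[ℝ] c d := by
  set p := inner ℍ[ℝ] a b - inner ℍ[ℝ] c d with hp
  -- Testing with the conjugate of the difference `p` produces Re(p p̄) = |p|².
  have h1 := congrArg Complex.re (h (star p))
  rw [complexInner_def, complexInner_def, quatInner_smul_right, quatInner_smul_right] at h1
  have h2 : (p * star p).re = 0 := by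
    nth_rewrite 1 [hp]
    rw [sub_mul, Quaternion.re_sub, sub_eq_zero]
    exact h1
  rw [Quaternion.self_mul_star, Quaternion.re_coe, Quaternion.normSq_eq_zero] at h2
  exact sub_eq_zero.mp h2

theorem continuous_op_smul (q : ℍ[ℝ]) : Continuous fun v : H => MulOpposite.op q • v := by
  refine AddMonoidHomClass.continuous_of_bound (DistribSMul.toAddMonoidHom H (MulOpposite.op q)) ‖q‖ ?_
  intro v
  exact (norm_op_smul q v).le

/-! ### Operators, adjoints and positivity through graphs -/

theorem complex_smul_mem (K : Submodule ℍ[ℝ]ᵐᵒᵖ (H × H)) {x y : H} (h : (x, y) ∈ K) (c : ℂ) :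
    (c • x, c • y) ∈ K :=
  K.smul_mem (MulOpposite.op (c : ℍ[ℝ])) h

theorem mem_graph_prod {E : Type*} [NormedAddCommGroup E] [Module ℍ[ℝ]ᵐᵒᵖ E]
    {S T : E →ₗ.[ℍ[ℝ]ᵐᵒᵖ] E} {x z : E} :
    (x, z) ∈ (prod S T).graph ↔ ∃ y, (x, y) ∈ T.graph ∧ (y, z) ∈ S.graph := by
  constructor
  · intro h
    obtain ⟨w, rfl, rfl⟩ := (LinearPMap.mem_graph_iff _).mp h
    exact ⟨_, (T.mem_graph ⟨w.1, w.2.fst⟩), S.mem_graph ⟨_, w.2.snd⟩⟩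
  · rintro ⟨y, h1, h2⟩
    obtain ⟨w, rfl, rfl⟩ := (LinearPMap.mem_graph_iff _).mp h1
    obtain ⟨u, hu, rfl⟩ := (LinearPMap.mem_graph_iff _).mp h2
    dsimp only at hu h2 ⊢
    have hd : (w : E) ∈ (prod S T).domain := ⟨w.2, hu ▸ u.2⟩
    convert (prod S T).mem_graph ⟨w, hd⟩ using 2
    exact congrArg S (Subtype.ext hu)

/-- The complex inner product suffices because the graph of `T` is stable under right multiplication
by all quaternions. -/
theorem mem_adjointGraph_iff {T : H →ₗ.[ℍ[ℝ]ᵐᵒᵖ] H} {x z : H} :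
    (x, z) ∈ adjointGraph T ↔ ∀ y w, (y, w) ∈ T.graph → inner ℂ x w = inner ℂ z y := by
  constructor
  · intro h y w hyw
    obtain ⟨u, rfl, rfl⟩ := (LinearPMap.mem_graph_iff _).mp hyw
    exact congrArg complexPart (h u)
  · intro h y
    refine quatInner_eq_of_complexInner_eq fun q => h _ _ ?_
    exact T.graph.smul_mem (MulOpposite.op q) (T.mem_graph y)

theorem isClosed_adjointGraph (T : H →ₗ.[ℍ[ℝ]ᵐᵒᵖ] H) : IsClosed (adjointGraph T : Set (H × H)) := by
  have : (adjointGraph T : Set (H × H)) =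
      ⋂ p ∈ T.graph, {u : H × H | inner ℂ u.1 p.2 = inner ℂ u.2 p.1} := by
    ext ⟨x, z⟩
    simp only [SetLike.mem_coe, mem_adjointGraph_iff, Set.mem_iInter, Set.mem_ofPred_eq, Prod.forall]
  rw [this]
  exact isClosed_biInter fun p _ => isClosed_eq (by fun_prop) (by fun_prop)

theorem commutesWith_iff {E : Type*} [NormedAddCommGroup E] [Module ℍ[ℝ]ᵐᵒᵖ E]
    {T : E →ₗ.[ℍ[ℝ]ᵐᵒᵖ] E} {B : E →L[ℍ[ℝ]ᵐᵒᵖ] E} :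
    CommutesWith T B ↔ ∀ x y, (x, y) ∈ T.graph → (B x, B y) ∈ T.graph := by
  constructor
  · intro h x y hxy
    obtain ⟨u, rfl, rfl⟩ := (LinearPMap.mem_graph_iff _).mp hxy
    obtain ⟨h1, h2⟩ := h u
    rw [← h2]
    exact T.mem_graph ⟨_, h1⟩
  · intro h x
    obtain ⟨u, hu, hu'⟩ := (LinearPMap.mem_graph_iff _).mp (h _ _ (T.mem_graph x))
    dsimp only at hu hu'
    refine ⟨hu ▸ u.2, ?_⟩
    rw [← hu']
    exact congrArg T (Subtype.ext hu.symm)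

theorem IsPositive.adjointGraph_eq {T : H →ₗ.[ℍ[ℝ]ᵐᵒᵖ] H} (hT : IsPositive T) :
    adjointGraph T = T.graph := by
  rw [← graph_adjoint T hT.dense_domain, hT.self_adjoint]

theorem IsPositive.isClosed_graph {T : H →ₗ.[ℍ[ℝ]ᵐᵒᵖ] H} (hT : IsPositive T) :
    IsClosed (T.graph : Set (H × H)) :=
  hT.adjointGraph_eq ▸ isClosed_adjointGraph T

theorem IsPositive.inner_comm {T : H →ₗ.[ℍ[ℝ]ᵐᵒᵖ] H} (hT : IsPositive T) {x y z w : H}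
    (h : (x, y) ∈ T.graph) (h' : (z, w) ∈ T.graph) : inner ℂ x w = inner ℂ y z :=
  mem_adjointGraph_iff.mp (hT.adjointGraph_eq ▸ h) z w h'

theorem IsPositive.re_inner_nonneg {T : H →ₗ.[ℍ[ℝ]ᵐᵒᵖ] H} (hT : IsPositive T) {x y : H}
    (h : (x, y) ∈ T.graph) : 0 ≤ (inner ℂ x y).re := by
  obtain ⟨u, rfl, rfl⟩ := (LinearPMap.mem_graph_iff _).mp h
  obtain ⟨r, hr, h⟩ := hT.nonneg u
  change 0 ≤ (inner ℍ[ℝ] (u : H) (T u)).re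
  rw [h]
  exact hr

/-- Symmetry already makes ⟨x | T x⟩ equal to its conjugate, hence real, so only the sign of the
real part needs checking. -/
theorem isPositive_of_graph {T : H →ₗ.[ℍ[ℝ]ᵐᵒᵖ] H} (hd : Dense (T.domain : Set H))
    (ha : adjointGraph T = T.graph) (hp : ∀ x y, (x, y) ∈ T.graph → 0 ≤ (inner ℂ x y).re) :
    IsPositive T where
  dense_domain := hd
  self_adjoint := LinearPMap.eq_of_eq_graph (by rw [graph_adjoint T hd, ha])
  nonneg x := by
    refine ⟨(inner ℍ[ℝ] (x : H) (T x)).re, hp _ _ (T.mem_graph x), ?_⟩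
    have h : ((x : H), T x) ∈ adjointGraph T := ha ▸ T.mem_graph x
    refine Quaternion.star_eq_self.mp ?_
    rw [← quatInner_conj_symm]
    exact (h x).symm

/-- Taking adjoints reverses inclusions, so self-adjoint operators have no proper self-adjoint
extensions. -/
theorem IsPositive.eq_of_graph_le {S T : H →ₗ.[ℍ[ℝ]ᵐᵒᵖ] H} (hS : IsPositive S)
    (hT : IsPositive T) (h : S.graph ≤ T.graph) : S = T := by
  refine LinearPMap.eq_of_eq_graph (le_antisymm h ?_)
  rw [← hS.adjointGraph_eq, ← hT.adjointGraph_eq]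
  rintro ⟨x, z⟩ hxz
  rw [mem_adjointGraph_iff] at hxz ⊢
  exact fun y w hyw => hxz y w (h hyw)

/-! ### The resolvent (1 + T)⁻¹ -/

/-- For positive `T`, the operator `1 + T` is bounded below on the graph norm. -/
theorem IsPositive.norm_sq_le {T : H →ₗ.[ℍ[ℝ]ᵐᵒᵖ] H} (hT : IsPositive T) {x y : H}
    (h : (x, y) ∈ T.graph) : ‖x‖ ^ 2 + ‖y‖ ^ 2 ≤ ‖x + y‖ ^ 2 := by
  have h1 := norm_add_sq x y
  have h2 : 0 ≤ (inner ℍ[ℝ] x y).re := hT.re_inner_nonneg h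
  linarith

/-- The range of `1 + T`, as a complex subspace of `H`. -/
def oneAddRange (T : H →ₗ.[ℍ[ℝ]ᵐᵒᵖ] H) : Submodule ℂ H where
  carrier := {v | ∃ x y, (x, y) ∈ T.graph ∧ x + y = v}
  add_mem' := by
    rintro _ _ ⟨x, y, h, rfl⟩ ⟨x', y', h', rfl⟩
    exact ⟨_, _, T.graph.add_mem h h', by abel⟩
  zero_mem' := ⟨0, 0, T.graph.zero_mem, add_zero 0⟩
  smul_mem' := by
    rintro c _ ⟨x, y, h, rfl⟩
    exact ⟨_, _, complex_smul_mem _ h c, (smul_add _ _ _).symm⟩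

/-- By `IsPositive.norm_sq_le`, (x, y) ↦ x + y is bounded below on the graph, which is complete. -/
theorem IsPositive.isClosed_oneAddRange [CompleteSpace H] {T : H →ₗ.[ℍ[ℝ]ᵐᵒᵖ] H}
    (hT : IsPositive T) : IsClosed (oneAddRange T : Set H) := by
  have : CompleteSpace T.graph := hT.isClosed_graph.completeSpace_coe
  let f : T.graph →+ H :=
    ((AddMonoidHom.fst H H) + (AddMonoidHom.snd H H)).comp T.graph.toAddSubmonoid.subtype
  have hf : AntilipschitzWith 1 f := by
    refine AddMonoidHomClass.antilipschitz_of_bound f fun p => ?_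
    have h := hT.norm_sq_le p.2
    change ‖(p : H × H)‖ ≤ ((1 : NNReal) : ℝ) * ‖p.1.1 + p.1.2‖
    rw [Prod.norm_def, NNReal.coe_one, one_mul]
    refine max_le ?_ ?_ <;> refine (sq_le_sq₀ (norm_nonneg _) (norm_nonneg _)).mp ?_ <;>
      nlinarith [sq_nonneg ‖p.1.1‖, sq_nonneg ‖p.1.2‖]
  have hu : UniformContinuous f :=
    uniformContinuous_addMonoidHom_of_continuous (by
      change Continuous fun p : T.graph => (p : H × H).1 + (p : H × H).2
      fun_prop)
  convert hf.isClosed_range hu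
  ext v
  constructor
  · rintro ⟨x, y, h, rfl⟩
    exact ⟨⟨(x, y), h⟩, rfl⟩
  · rintro ⟨⟨⟨x, y⟩, h⟩, rfl⟩
    exact ⟨x, y, h, rfl⟩

/-- A vector z orthogonal to the closed range of 1 + T satisfies T z = T* z = -z, and the lower
bound on 1 + T forces z = 0. -/
theorem IsPositive.exists_add_eq [CompleteSpace H] {T : H →ₗ.[ℍ[ℝ]ᵐᵒᵖ] H}
    (hT : IsPositive T) (v : H) : ∃ x y, (x, y) ∈ T.graph ∧ x + y = v := by
  have : CompleteSpace (oneAddRange T) := hT.isClosed_oneAddRange.completeSpace_coe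
  suffices oneAddRange T = ⊤ from (this ▸ Submodule.mem_top : v ∈ oneAddRange T)
  rw [← Submodule.orthogonal_eq_bot_iff, Submodule.eq_bot_iff]
  intro z hz
  have h1 : (z, -z) ∈ T.graph := by
    rw [← hT.adjointGraph_eq, mem_adjointGraph_iff]
    intro y w hyw
    have := (Submodule.mem_orthogonal' _ _).mp hz (y + w) ⟨y, w, hyw, rfl⟩
    rw [inner_add_right] at this
    rw [inner_neg_left]
    exact eq_neg_of_add_eq_zero_right this
  have h2 := hT.norm_sq_le h1
  rw [add_neg_cancel, norm_neg, norm_zero] at h2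
  have h3 : ‖z‖ ^ 2 = 0 := by nlinarith [sq_nonneg ‖z‖]
  simpa using h3

theorem IsPositive.add_injective {T : H →ₗ.[ℍ[ℝ]ᵐᵒᵖ] H} (hT : IsPositive T) {x y z w : H}
    (h : (x, y) ∈ T.graph) (h' : (z, w) ∈ T.graph) (he : x + y = z + w) : x = z := by
  have h2 := hT.norm_sq_le (T.graph.sub_mem h h')
  dsimp only at h2
  rw [show x - z + (y - w) = x + y - (z + w) by abel, he, sub_self, norm_zero] at h2
  have h3 : ‖x - z‖ ^ 2 = 0 := by nlinarith [sq_nonneg ‖x - z‖, sq_nonneg ‖y - w‖]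
  exact sub_eq_zero.mp (by simpa using h3)

/-- The bounded inverse of `1 + T`, for positive `T`. -/
theorem IsPositive.exists_resolvent [CompleteSpace H] {T : H →ₗ.[ℍ[ℝ]ᵐᵒᵖ] H}
    (hT : IsPositive T) : ∃ A : H →L[ℂ] H, 0 ≤ A ∧ 0 ≤ 1 - A ∧
      (∀ v, (A v, v - A v) ∈ T.graph) ∧ ∀ x y, (x, y) ∈ T.graph → A (x + y) = x := by
  choose a b hab hv using hT.exists_add_eq
  have hu : ∀ x y, (x, y) ∈ T.graph → a (x + y) = x := fun x y h =>
    hT.add_injective (hab _) h (hv _)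
  have hb : ∀ v, b v = v - a v := fun v => eq_sub_of_add_eq' (hv v)
  let A : H →L[ℂ] H := LinearMap.mkContinuous
    { toFun := a
      map_add' := fun v w => by
        rw [← hu _ _ (T.graph.add_mem (hab v) (hab w))]
        congr 1
        change v + w = a v + a w + (b v + b w)
        rw [hb, hb]; abel
      map_smul' := fun c v => by
        rw [RingHom.id_apply, ← hu _ _ (complex_smul_mem _ (hab v) c), ← smul_add, hv] } 1 (by
    intro v
    have := hT.norm_sq_le (hab v)
    rw [hv] at this
    rw [one_mul]
    refine (sq_le_sq₀ (norm_nonneg _) (norm_nonneg _)).mp ?_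
    change ‖a v‖ ^ 2 ≤ _
    nlinarith [sq_nonneg ‖b v‖])
  have hA : ∀ v, (A v, v - A v) ∈ T.graph := fun v => hb v ▸ hab v
  have hs : ∀ v w, inner ℂ (A v) w = inner ℂ v (A w) := by
    intro v w
    have := hT.inner_comm (hA v) (hA w)
    rw [inner_sub_right, inner_sub_left] at this
    linear_combination this
  -- This inequality yields both bounds: adding ‖A v‖² gives Re⟨A v, v⟩ ≥ 0, and adding ‖v - A v‖²
  -- gives Re⟨v - A v, v⟩ ≥ 0.
  have hre : ∀ v, 0 ≤ (inner ℂ (A v) (v - A v)).re := fun v => hT.re_inner_nonneg (hA v)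
  have hn : ∀ v : H, 0 ≤ (inner ℂ v v).re := fun v => by
    exact inner_self_nonneg (𝕜 := ℂ) (x := v)
  refine ⟨A, ?_, ?_, hA, hu⟩
  · rw [ContinuousLinearMap.nonneg_iff_isPositive]
    refine ContinuousLinearMap.isPositive_def.mpr ⟨hs, fun v => ?_⟩
    have h1 := hre v
    rw [inner_sub_right, Complex.sub_re] at h1
    have h2 := hn (A v)
    change 0 ≤ (inner ℂ (A v) v).re
    linarith
  · rw [ContinuousLinearMap.nonneg_iff_isPositive]
    refine ContinuousLinearMap.isPositive_def.mpr ⟨fun v w => ?_, fun v => ?_⟩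
    · change inner ℂ (v - A v) w = inner ℂ v (w - A w)
      rw [inner_sub_right, inner_sub_left, hs]
    · change 0 ≤ (inner ℂ (v - A v) v).re
      have h1 := hre v
      have h2 := hn (v - A v)
      rw [← inner_conj_symm, Complex.conj_re] at h1
      rw [inner_sub_right, Complex.sub_re] at h2
      linarith

/-! ### The square root D C⁻¹: existence, uniqueness, commutation -/

theorem dense_of_forall_inner_eq_zero [CompleteSpace H] (K : Submodule ℍ[ℝ]ᵐᵒᵖ H)
    (h : ∀ z, (∀ x ∈ K, inner ℂ x z = 0) → z = 0) : Dense (K : Set H) := by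
  let L : Submodule ℂ H :=
    { K.toAddSubmonoid with smul_mem' := fun c _ hx => K.smul_mem (MulOpposite.op (c : ℍ[ℝ])) hx }
  change Dense (L : Set H)
  rw [Submodule.dense_iff_topologicalClosure_eq_top, Submodule.topologicalClosure_eq_top_iff,
    Submodule.eq_bot_iff]
  exact fun z hz => h z ((Submodule.mem_orthogonal _ _).mp hz)

/-- The positive operator `D C⁻¹` determined by commuting positive bounded operators `C`, `D` with
`C ^ 2 + D ^ 2 = 1` and `C` injective, together with its square. -/
theorem exists_isPositive_of_sqrt_pair [CompleteSpace H] {C D : H →L[ℂ] H} (hC : 0 ≤ C)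
    (hD : 0 ≤ D) (hCD : Commute C D) (h1 : ∀ v, C (C v) + D (D v) = v)
    (h0 : ∀ v, C v = 0 → v = 0)
    (hCq : ∀ (q : ℍ[ℝ]) v, C (MulOpposite.op q • v) = MulOpposite.op q • C v)
    (hDq : ∀ (q : ℍ[ℝ]) v, D (MulOpposite.op q • v) = MulOpposite.op q • D v) :
    ∃ S : H →ₗ.[ℍ[ℝ]ᵐᵒᵖ] H, IsPositive S ∧ (∀ x y, (x, y) ∈ S.graph ↔ ∃ v, C v = x ∧ D v = y) ∧
      ∀ x y, (x, y) ∈ (prod S S).graph ↔ ∃ v, C (C v) = x ∧ D (D v) = y := by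
  have hc : ∀ v, C (D v) = D (C v) := fun v => DFunLike.congr_fun hCD v
  have hCs : ∀ v w, inner ℂ (C v) w = inner ℂ v (C w) :=
    ((ContinuousLinearMap.nonneg_iff_isPositive C).mp hC).isSymmetric
  have hDs : ∀ v w, inner ℂ (D v) w = inner ℂ v (D w) :=
    ((ContinuousLinearMap.nonneg_iff_isPositive D).mp hD).isSymmetric
  let G : Submodule ℍ[ℝ]ᵐᵒᵖ (H × H) :=
    { carrier := {p | ∃ v, C v = p.1 ∧ D v = p.2}
      add_mem' := by
        rintro ⟨_, _⟩ ⟨_, _⟩ ⟨v, rfl, rfl⟩ ⟨w, rfl, rfl⟩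
        exact ⟨v + w, map_add _ _ _, map_add _ _ _⟩
      zero_mem' := ⟨0, map_zero _, map_zero _⟩
      smul_mem' := by
        rintro q ⟨_, _⟩ ⟨v, rfl, rfl⟩
        exact ⟨q • v, hCq q.unop v, hDq q.unop v⟩ }
  have hG : G.toLinearPMap.graph = G := by
    refine Submodule.toLinearPMap_graph_eq _ ?_
    rintro ⟨x, y⟩ ⟨v, hx, hy⟩ hz
    dsimp only at hx hy hz ⊢
    rw [← hy, h0 v (hx.trans hz), map_zero]
  have hS : ∀ x y, (x, y) ∈ G.toLinearPMap.graph ↔ ∃ v, C v = x ∧ D v = y := by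
    intro x y
    rw [hG]
    rfl
  refine ⟨G.toLinearPMap, isPositive_of_graph ?_ ?_ ?_, hS, ?_⟩
  · refine dense_of_forall_inner_eq_zero _ fun z hz => h0 z ?_
    refine ext_inner_left ℂ fun v => ?_
    rw [← hCs, inner_zero_right]
    exact hz _ (LinearPMap.mem_domain_of_mem_graph ((hS _ _).mpr ⟨v, rfl, rfl⟩))
  · ext ⟨x, z⟩
    rw [mem_adjointGraph_iff, hS]
    constructor
    · intro h
      have h2 : D x = C z := by
        refine ext_inner_right ℂ fun v => ?_
        rw [hDs, hCs]
        exact h _ _ ((hS _ _).mpr ⟨v, rfl, rfl⟩)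
      -- If C v = x and D v = z, then v = C² v + D² v = C x + D z.
      refine ⟨C x + D z, ?_, ?_⟩
      · rw [map_add, hc, ← h2, h1]
      · rw [map_add, ← hc, h2, h1]
    · rintro ⟨v, rfl, rfl⟩ y w hyw
      obtain ⟨u, rfl, rfl⟩ := (hS _ _).mp hyw
      rw [hCs, hDs, hc]
  · intro x y hxy
    obtain ⟨v, rfl, rfl⟩ := (hS _ _).mp hxy
    rw [hCs]
    exact ((ContinuousLinearMap.nonneg_iff_isPositive _).mp
      (Commute.mul_nonneg hC hD hCD)).re_inner_nonneg_right v
  · intro x z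
    rw [mem_graph_prod]
    constructor
    · rintro ⟨y, hxy, hyz⟩
      obtain ⟨v, rfl, rfl⟩ := (hS _ _).mp hxy
      obtain ⟨w, hw, rfl⟩ := (hS _ _).mp hyz
      -- Here D v = C w, so C² v + C D w = C² v + D² v = v.
      have hv : C (C v + D w) = v := by
        rw [map_add, hc, hw, h1]
      refine ⟨C v + D w, by rw [hv], ?_⟩
      rw [map_add D, ← hc, ← hw, h1]
    · rintro ⟨v, rfl, rfl⟩
      exact ⟨D (C v), (hS _ _).mpr ⟨C v, rfl, rfl⟩, (hS _ _).mpr ⟨D v, hc v, rfl⟩⟩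

theorem IsPositive.exists_sqrt [CompleteSpace H] {T : H →ₗ.[ℍ[ℝ]ᵐᵒᵖ] H} (hT : IsPositive T) :
    ∃ S, IsPositiveSqrt S T ∧ (∀ S', IsPositiveSqrt S' T → S' = S) ∧
      ∀ B : H →L[ℍ[ℝ]ᵐᵒᵖ] H, CommutesWith T B → CommutesWith S B := by
  obtain ⟨A, hA, hA', hAT, hTA⟩ := hT.exists_resolvent
  obtain ⟨C, D, hC, hD, hCC, hDD, hCD, hcomm⟩ := exists_sqrt_pair hA hA'
  have hCA : ∀ v, C (C v) = A v := DFunLike.congr_fun hCC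
  have hDA : ∀ v, D (D v) = v - A v := DFunLike.congr_fun hDD
  have hc : ∀ v, C (D v) = D (C v) := DFunLike.congr_fun hCD
  have h0 : ∀ v, C v = 0 → v = 0 := by
    intro v hv
    have hAv : A v = 0 := by rw [← hCA, hv, map_zero]
    -- A v = 0 puts (0, v) in the graph of T.
    have := T.graph_fst_eq_zero_snd (hAT v) hAv
    rwa [hAv, sub_zero] at this
  have hq := fun q : ℍ[ℝ] => hcomm (DistribSMul.toAddMonoidHom H (MulOpposite.op q))
    (continuous_op_smul q) fun v => by
      have := hTA _ _ (T.graph.smul_mem (MulOpposite.op q) (hAT v))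
      rw [← smul_add, add_sub_cancel] at this
      exact this.symm
  obtain ⟨S, hS, hSg, hSS⟩ := exists_isPositive_of_sqrt_pair hC hD hCD
    (fun v => by rw [hCA, hDA, add_sub_cancel]) h0
    (fun q v => ((hq q).1 v).symm) (fun q v => ((hq q).2 v).symm)
  have hT' : ∀ x y, (x, y) ∈ T.graph ↔ ∃ v, A v = x ∧ v - A v = y := by
    intro x y
    constructor
    · intro h
      refine ⟨x + y, hTA _ _ h, ?_⟩
      rw [hTA _ _ h, add_sub_cancel_left]
    · rintro ⟨v, rfl, rfl⟩
      exact hAT v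
  refine ⟨S, ⟨hS, LinearPMap.eq_of_eq_graph ?_⟩, ?_, ?_⟩
  · ext ⟨x, y⟩
    rw [hSS, hT']
    simp only [hCA, hDA]
  · rintro R ⟨hR, hRT⟩
    refine (hS.eq_of_graph_le hR ?_).symm
    -- A v lies in D(T) = D(R²); the vector chosen below is p v = R A v.
    have hRA : ∀ v, ∃ p, (A v, p) ∈ R.graph ∧ (p, v - A v) ∈ R.graph := by
      intro v
      exact mem_graph_prod.mp (hRT ▸ hAT v)
    choose p hp hp' using hRA
    have hpu : ∀ v x, (A v, x) ∈ R.graph → p v = x := fun v x h =>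
      LinearPMap.mem_graph_snd_inj R (hp v) h rfl
    -- Symmetry of R gives ‖p v‖² = Re⟨A v, v - A v⟩, a term in the expansion of ‖A v + (v - A v)‖².
    have hpb : ∀ v, ‖p v‖ ≤ 1 * ‖v‖ := by
      intro v
      have h1 := hR.inner_comm (hp v) (hp' v)
      have h2 := congrArg Complex.re h1
      have h3 : (inner ℂ (p v) (p v)).re = ‖p v‖ ^ 2 := inner_self_eq_norm_sq (𝕜 := ℂ) (p v)
      have h4 := norm_add_sq (A v) (v - A v)
      have h5 : (inner ℂ (A v) (v - A v)).re = (inner ℍ[ℝ] (A v) (v - A v)).re := rfl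
      rw [add_sub_cancel] at h4
      rw [one_mul]
      refine (sq_le_sq₀ (norm_nonneg _) (norm_nonneg _)).mp ?_
      nlinarith [sq_nonneg ‖A v‖, sq_nonneg ‖v - A v‖, sq_nonneg ‖p v‖]
    let P : H →L[ℂ] H := LinearMap.mkContinuous
      { toFun := p
        map_add' := fun v w => hpu _ _ (by
          rw [map_add]
          exact R.graph.add_mem (hp v) (hp w))
        map_smul' := fun c v => hpu _ _ (by
          rw [map_smul]
          exact complex_smul_mem _ (hp v) c) } 1 hpb
    have hP : 0 ≤ P := by
      rw [ContinuousLinearMap.nonneg_iff_isPositive]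
      refine ContinuousLinearMap.isPositive_def.mpr ⟨fun v w => ?_, fun v => ?_⟩
      · change inner ℂ (p v) w = inner ℂ v (p w)
        have h1 := hR.inner_comm (hp v) (hp w)
        have h2 := hR.inner_comm (hp' v) (hp' w)
        rw [inner_sub_right, inner_sub_left] at h2
        linear_combination h2 - h1
      · change 0 ≤ (inner ℂ (p v) v).re
        have h1 := hR.re_inner_nonneg (hp v)
        have h2 := hR.re_inner_nonneg (hp' v)
        rw [hR.inner_comm (hp v) (hp v)] at h1
        rw [inner_sub_right, Complex.sub_re] at h2
        linarith
    have hPP : P * P = (C * D) * (C * D) := by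
      refine ContinuousLinearMap.ext fun v => ?_
      change p (p v) = C (D (C (D v)))
      rw [← hc, hCA, hDA, map_sub]
      -- This shows A p v = p A v, so p p v = R A p v = R p A v = R² A² v = A v - A² v.
      have h1 : (p (A v), p v - p (A v)) ∈ T.graph := by
        rw [← hRT]
        exact mem_graph_prod.mpr ⟨_, hp' (A v), R.graph.sub_mem (hp v) (hp (A v))⟩
      have h2 := hTA _ _ h1
      rw [add_sub_cancel] at h2
      exact hpu _ _ (h2 ▸ hp' (A v))
    have hPCD : P = C * D :=
      (CFC.mul_self_eq_mul_self_iff P (C * D) hP (Commute.mul_nonneg hC hD hCD)).mp hPP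
    rintro ⟨x, y⟩ hxy
    obtain ⟨v, rfl, rfl⟩ := (hSg _ _).mp hxy
    -- The set is closed and contains the range of C, because C (C w) = A w and D (C w) = R A w.
    -- That range is the domain of S, hence dense.
    have hcl : IsClosed {v | (C v, D v) ∈ R.graph} :=
      hR.isClosed_graph.preimage (by fun_prop : Continuous fun v => (C v, D v))
    refine closure_minimal ?_ hcl (hS.dense_domain v)
    intro x hx
    obtain ⟨y, hy⟩ := LinearPMap.mem_domain_iff.mp hx
    obtain ⟨w, rfl, rfl⟩ := (hSg _ _).mp hy
    change (C (C w), D (C w)) ∈ R.graph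
    have : p w = C (D w) := DFunLike.congr_fun hPCD w
    rw [hCA, ← hc, ← this]
    exact hp w
  · intro B hB
    rw [commutesWith_iff] at hB ⊢
    have hBA := hcomm B.toLinearMap.toAddMonoidHom B.continuous fun v => by
      have := hTA _ _ (hB _ _ (hAT v))
      rw [← map_add, add_sub_cancel] at this
      exact this.symm
    intro x y hxy
    obtain ⟨v, rfl, rfl⟩ := (hSg _ _).mp hxy
    exact (hSg _ _).mpr ⟨B v, (hBA.1 v).symm, (hBA.2 v).symm⟩

/-! ### Positivity of T*T -/

/-- The graph of an operator, as a complex subspace of the Hilbert sum `H ⊕ H`. -/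
def hilbertGraph (T : H →ₗ.[ℍ[ℝ]ᵐᵒᵖ] H) : Submodule ℂ (WithLp 2 (H × H)) where
  carrier := WithLp.ofLp ⁻¹' (T.graph : Set (H × H))
  add_mem' h h' := T.graph.add_mem h h'
  zero_mem' := T.graph.zero_mem
  smul_mem' c p h := complex_smul_mem T.graph (x := p.fst) (y := p.snd) h c

/-- Let (x, y) be the orthogonal projection of (v, 0) onto the graph of T. The residual (v - x, -y)
is orthogonal to the graph, which says exactly that T* y = v - x. -/
theorem exists_add_adjoint_comp_self_eq [CompleteSpace H] {T : H →ₗ.[ℍ[ℝ]ᵐᵒᵖ] H}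
    (hd : Dense (T.domain : Set H)) (hc : IsClosed (T.graph : Set (H × H))) (v : H) :
    ∃ x y z, (x, y) ∈ T.graph ∧ (y, z) ∈ (adjoint T).graph ∧ x + z = v := by
  have hcl : IsClosed (hilbertGraph T : Set (WithLp 2 (H × H))) :=
    hc.preimage (WithLp.prod_continuous_ofLp 2 H H)
  have : CompleteSpace (hilbertGraph T) := hcl.completeSpace_coe
  let u : WithLp 2 (H × H) := WithLp.toLp 2 (v, 0)
  let p := (hilbertGraph T).starProjection u
  have hp : (p.fst, p.snd) ∈ T.graph := (hilbertGraph T).starProjection_apply_mem u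
  refine ⟨p.fst, p.snd, v - p.fst, hp, ?_, add_sub_cancel _ _⟩
  rw [graph_adjoint T hd, mem_adjointGraph_iff]
  intro y w hyw
  have h := (Submodule.mem_orthogonal' _ _).mp
    ((hilbertGraph T).sub_starProjection_mem_orthogonal u) (WithLp.toLp 2 (y, w)) hyw
  rw [WithLp.prod_inner_apply] at h
  change inner ℂ (v - p.fst) y + inner ℂ (0 - p.snd) w = 0 at h
  rw [zero_sub, inner_neg_left] at h
  linear_combination -h

/-- von Neumann: `T* T` is positive for closed densely defined `T`. -/
theorem isPositive_adjoint_prod_self [CompleteSpace H] {T : H →ₗ.[ℍ[ℝ]ᵐᵒᵖ] H}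
    (hd : Dense (T.domain : Set H)) (hc : IsClosed (T.graph : Set (H × H))) :
    IsPositive (prod (adjoint T) T) := by
  have hadj : ∀ {x y z w}, (x, y) ∈ T.graph → (z, w) ∈ (adjoint T).graph →
      inner ℂ z y = inner ℂ w x := fun h h' => by
    rw [graph_adjoint T hd, mem_adjointGraph_iff] at h'
    exact h' _ _ h
  have hsymm : ∀ {x y z w}, (x, y) ∈ (prod (adjoint T) T).graph →
      (z, w) ∈ (prod (adjoint T) T).graph → inner ℂ x w = inner ℂ y z := fun h h' => by
    obtain ⟨a, ha, ha'⟩ := mem_graph_prod.mp h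
    obtain ⟨b, hb, hb'⟩ := mem_graph_prod.mp h'
    rw [← hadj hb ha', ← inner_conj_symm, ← hadj ha hb', inner_conj_symm]
  have hsurj : ∀ v, ∃ x z, (x, z) ∈ (prod (adjoint T) T).graph ∧ x + z = v := fun v => by
    obtain ⟨x, y, z, h, h', hv⟩ := exists_add_adjoint_comp_self_eq hd hc v
    exact ⟨x, z, mem_graph_prod.mpr ⟨y, h, h'⟩, hv⟩
  have hpos : ∀ x z, (x, z) ∈ (prod (adjoint T) T).graph → 0 ≤ (inner ℂ x z).re := by
    intro x z h
    obtain ⟨y, h, h'⟩ := mem_graph_prod.mp h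
    rw [← inner_conj_symm, Complex.conj_re, ← hadj h h']
    exact inner_self_nonneg (𝕜 := ℂ) (x := y)
  refine isPositive_of_graph ?_ ?_ hpos
  -- Write v = x + T*T x. Orthogonality to x gives ‖x‖² + Re⟨x, T*T x⟩ = 0, so x = 0 and v = 0.
  · refine dense_of_forall_inner_eq_zero _ fun v hv => ?_
    obtain ⟨x, z, h, rfl⟩ := hsurj v
    have h1 := congrArg Complex.re (hv x (LinearPMap.mem_domain_of_mem_graph h))
    have h2 : (inner ℂ x x).re = ‖x‖ ^ 2 := inner_self_eq_norm_sq (𝕜 := ℂ) x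
    rw [inner_add_right, Complex.add_re, h2, Complex.zero_re] at h1
    have h3 := hpos x z h
    have h4 : ‖x‖ ^ 2 = 0 := by nlinarith [sq_nonneg ‖x‖]
    have h5 : x = 0 := by simpa using h4
    rw [LinearPMap.graph_fst_eq_zero_snd _ h h5, h5, add_zero]
  · refine le_antisymm ?_ ?_
    · rintro ⟨x, z⟩ hxz
      rw [mem_adjointGraph_iff] at hxz
      -- Choose y in the domain with y + T*T y = x + z. Then x - y is orthogonal to the range of 1 +
      -- T*T, which is all of H.
      obtain ⟨y, w, hyw, he⟩ := hsurj (x + z)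
      have : x = y := by
        refine ext_inner_right ℂ fun v => ?_
        obtain ⟨a, b, hab, rfl⟩ := hsurj v
        have h1 := hxz _ _ hab
        have h2 := hsymm hyw hab
        have h3 := congrArg (fun t => inner ℂ t a) he
        simp only [inner_add_left] at h3
        rw [inner_add_right, inner_add_right]
        linear_combination h1 - h2 - h3
      subst this
      rwa [← add_left_cancel he]
    · rintro ⟨x, z⟩ hxz
      rw [mem_adjointGraph_iff]
      exact fun y w hyw => hsymm hxz hyw

end QuaternionicHilbert

end

theorem mainTheorem4 {H : Type*} [NormedAddCommGroup H] [Module ℍ[ℝ]ᵐᵒᵖ H]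
    [QuaternionicInnerProductSpace H] [CompleteSpace H] :
    (∀ T : H →ₗ.[ℍ[ℝ]ᵐᵒᵖ] H, QuaternionicHilbert.IsPositive T →
      (∃! S : H →ₗ.[ℍ[ℝ]ᵐᵒᵖ] H, QuaternionicHilbert.IsPositiveSqrt S T) ∧
      ∀ S : H →ₗ.[ℍ[ℝ]ᵐᵒᵖ] H, QuaternionicHilbert.IsPositiveSqrt S T →
        ∀ B : H →L[ℍ[ℝ]ᵐᵒᵖ] H, QuaternionicHilbert.CommutesWith T B →
          QuaternionicHilbert.CommutesWith S B) ∧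
    (∀ T : H →ₗ.[ℍ[ℝ]ᵐᵒᵖ] H, Dense (T.domain : Set H) → IsClosed (T.graph : Set (H × H)) →
      (∃! S : H →ₗ.[ℍ[ℝ]ᵐᵒᵖ] H, QuaternionicHilbert.IsPositiveSqrt S
        (QuaternionicHilbert.prod (QuaternionicHilbert.adjoint T) T)) ∧
      ∀ S : H →ₗ.[ℍ[ℝ]ᵐᵒᵖ] H, QuaternionicHilbert.IsPositiveSqrt S
          (QuaternionicHilbert.prod (QuaternionicHilbert.adjoint T) T) →
        ∀ B : H →L[ℍ[ℝ]ᵐᵒᵖ] H, QuaternionicHilbert.CommutesWith T B →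
          QuaternionicHilbert.CommutesWith (QuaternionicHilbert.adjoint T) B →
          QuaternionicHilbert.CommutesWith S B) := by
  have key : ∀ T : H →ₗ.[ℍ[ℝ]ᵐᵒᵖ] H, QuaternionicHilbert.IsPositive T →
      (∃! S : H →ₗ.[ℍ[ℝ]ᵐᵒᵖ] H, QuaternionicHilbert.IsPositiveSqrt S T) ∧
      ∀ S : H →ₗ.[ℍ[ℝ]ᵐᵒᵖ] H, QuaternionicHilbert.IsPositiveSqrt S T →
        ∀ B : H →L[ℍ[ℝ]ᵐᵒᵖ] H, QuaternionicHilbert.CommutesWith T B →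
          QuaternionicHilbert.CommutesWith S B := by
    intro T hT
    obtain ⟨S, hS, huniq, hcomm⟩ := hT.exists_sqrt
    refine ⟨⟨S, hS, huniq⟩, fun R hR B hB => ?_⟩
    rw [huniq R hR]
    exact hcomm B hB
  refine ⟨key, fun T hd hc => ?_⟩
  obtain ⟨h1, h2⟩ := key _ (QuaternionicHilbert.isPositive_adjoint_prod_self hd hc)
  refine ⟨h1, fun S hS B hB hB' => h2 S hS B ?_⟩
  rw [QuaternionicHilbert.commutesWith_iff] at hB hB' ⊢
  intro x z hxz
  obtain ⟨y, hxy, hyz⟩ := QuaternionicHilbert.mem_graph_prod.mp hxz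
  exact QuaternionicHilbert.mem_graph_prod.mpr ⟨B y, hB _ _ hxy, hB' _ _ hyz⟩
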